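/- Let $\mathcal X$ be a context space with context distribution $\nu$, let $\mathcal A=[K]$ be a finite action set, and for each $(x,a)$ let $p(\cdot\mid x,a)$ be a cost distribution on $[-1,0]$ (deterministic costs are the special case of Dirac masses). A policy $\pi$ gives for each $x$ a probability distribution $\pi(\cdot\mid x)$ on $\mathcal A$; $\mu_\pi$ is the joint law of $(x,a,c)$ with $x\sim\nu$, $a\sim\pi(\cdot\mid x)$, $c\sim p(\cdot\mid x,a)$, and $R(\pi)=\mathbb E_{(x,a,c)\sim\mu_\pi}[c]$. Let $\pi_0$ be a logging policy and $\mathcal D_n=(x_i,a_i,c_i)_{i\in[n]}\sim\mu_{\pi_0}^n$ i.i.d. Let $\mathcal H$ be a hypothesis space of maps $h:\mathcal X\to\mathcal A$ (with $(h,x)\mapsto h(x)$ measurable), and for a probability distribution $\mathbb Q$ on $\mathcal H$ put $\pi_{\mathbb Q}(a\mid x)=\mathbb E_{h\sim\mathbb Q}[\mathbb 1\{h(x)=a\}]$. Proposition (one-sided bound, uniform in $\alpha$). Let $n\ge 1$, $\delta\in(0,1]$, $\lambda>0$, and let $\mathbb P$ be a fixed prior on $\mathcal H$. Then with probability at least $1-\delta$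 over draws $\mathcal D_n\sim\mu_{\pi_0}^n$, the following holds simultaneously for all posteriors $\mathbb Q$ on $\mathcal H$ and all $\alpha\in(0,1]$: $$R(\pi_{\mathbb Q})\le \hat R_n^\alpha(\pi_{\mathbb Q})+\sqrt{\frac{D_{\mathrm{KL}}(\mathbb Q\|\mathbb P)+\log\frac{8\sqrt n}{\delta\alpha}}{2n}}+B_n^\alpha(\pi_{\mathbb Q})+\frac{D_{\mathrm{KL}}(\mathbb Q\|\mathbb P)+\log\frac{8}{\delta\alpha}}{n\lambda}+\frac{\lambda}{2}\bar V_n^\alpha(\pi_{\mathbb Q}),$$ where the right-hand side is $+\infty$ if $D_{\mathrm{KL}}(\mathbb Q\|\mathbb P)=\infty$, and $$\hat R_n^\alpha(\pi)=\frac1n\sum_{i=1}^n c_i\,\frac{\pi(a_i\mid x_i)}{\pi_0(a_i\mid x_i)^\alpha},\qquad B_n^\alpha(\pi)=1-\frac1n\sum_{i=1}^n\mathbb E_{a\sim\pi(\cdot\mid x_i)}\big[\pi_0(a\mid x_i)^{1-\alpha}\big],$$ $$\bar V_n^\alpha(\pi)=\frac1n\sum_{i=1}^n\Big(\mathbb E_{a\sim\pi_0(\cdot\mid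 x_i)}\Big[\frac{\pi(a\mid x_i)}{\pi_0(a\mid x_i)^{2\alpha}}\Big]+\frac{\pi(a_i\mid x_i)}{\pi_0(a_i\mid x_i)^{2\alpha}}\,c_i^2\Big),$$ with the convention $0^0=1$. -/

import Mathlib

open MeasureTheory ProbabilityTheory InformationTheory

noncomputable section

namespace OffPolicy

variable {X H : Type*} [MeasurableSpace X] [MeasurableSpace H] {K n : ℕ}

/-- A logged sample `((x, a), c)`: context, action, cost. -/
abbrev Sample (X : Type*) (K : ℕ) : Type _ := (X × Fin K) × ℝ

/-- `π(a | x)`, the probability that the policy `π` plays `a` in context `x`. -/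
def actionProb (π : Kernel X (Fin K)) (a : Fin K) (x : X) : ℝ := (π x).real {a}

/-- The joint law `μ_π` of `((x, a), c)`, where `x ∼ ν`, `a ∼ π(· | x)`, `c ∼ p(· | x, a)`. -/
def jointLaw (ν : Measure X) (p : Kernel (X × Fin K) ℝ) (π : Kernel X (Fin K)) :
    Measure (Sample X K) :=
  (ν ⊗ₘ π) ⊗ₘ p

/-- The law of `n` i.i.d. samples logged by `π₀`. -/
def dataLaw (ν : Measure X) (p : Kernel (X × Fin K) ℝ) (π₀ : Kernel X (Fin K)) (n : ℕ) :
    Measure (Fin n → Sample X K) :=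
  Measure.pi fun _ => jointLaw ν p π₀

/-- The risk `R(π) = E_{(x, a, c) ∼ μ_π}[c]`. -/
def risk (ν : Measure X) (p : Kernel (X × Fin K) ℝ) (π : Kernel X (Fin K)) : ℝ :=
  ∫ z, z.2 ∂(jointLaw ν p π)

/-- The policy `π_Q` induced by a distribution `Q` on the hypothesis space: `π_Q(· | x)` is the
law of `h(x)` for `h ∼ Q`. A hypothesis `h : H` acts on contexts as `pred h : X → Fin K`. -/
def inducedPolicy (pred : H → X → Fin K)
    (hpred : Measurable fun q : H × X => pred q.1 q.2)
    (Q : Measure H) [IsProbabilityMeasure Q] : Kernel X (Fin K) where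
  toFun x := Q.map fun h => pred h x
  measurable' := by
    refine Measure.measurable_of_measurable_coe _ fun s hs => ?_
    have h1 : ∀ x, (Q.map fun h => pred h x) s
        = Q ((fun h => (h, x)) ⁻¹' ((fun q : H × X => pred q.1 q.2) ⁻¹' s)) := fun x =>
      Measure.map_apply (hpred.comp measurable_prodMk_right) hs
    simp_rw [h1]
    exact measurable_measure_prodMk_right (hpred hs)

/-- `π_Q(a | x) = E_{h ∼ Q}[1{h(x) = a}]`. -/
theorem actionProb_inducedPolicy (pred : H → X → Fin K)
    (hpred : Measurable fun q : H × X => pred q.1 q.2)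
    (Q : Measure H) [IsProbabilityMeasure Q] (a : Fin K) (x : X) :
    actionProb (inducedPolicy pred hpred Q) a x = ∫ h, (if pred h x = a then 1 else 0) ∂Q := by
  have hm : Measurable fun h => pred h x := hpred.comp measurable_prodMk_right
  have hs : MeasurableSet {h | pred h x = a} := hm (measurableSet_singleton a)
  have h1 : (fun h => if pred h x = a then (1 : ℝ) else 0)
      = Set.indicator {h | pred h x = a} 1 := by
    funext h; simp [Set.indicator_apply]
  rw [h1, integral_indicator_one hs]
  change (Q.map fun h => pred h x).real {a} = _
  rw [map_measureReal_apply hm (measurableSet_singleton a)]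
  rfl

/-- The exponentially smoothed estimator
`R̂ₙ^α(π) = (1/n) ∑ᵢ cᵢ π(aᵢ | xᵢ) / π₀(aᵢ | xᵢ)^α`. -/
def smoothedIPS (π₀ : Kernel X (Fin K)) (α : ℝ) (D : Fin n → Sample X K)
    (π : Kernel X (Fin K)) : ℝ :=
  (1 / (n : ℝ)) * ∑ i, (D i).2 *
    (actionProb π (D i).1.2 (D i).1.1 / actionProb π₀ (D i).1.2 (D i).1.1 ^ α)

/-- `Bₙ^α(π) = 1 - (1/n) ∑ᵢ E_{a ∼ π(· | xᵢ)}[π₀(a | xᵢ)^(1 - α)]`. -/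
def biasTerm (π₀ : Kernel X (Fin K)) (α : ℝ) (D : Fin n → Sample X K)
    (π : Kernel X (Fin K)) : ℝ :=
  1 - (1 / (n : ℝ)) * ∑ i, ∫ a, actionProb π₀ a (D i).1.1 ^ (1 - α) ∂(π (D i).1.1)

/-- `V̄ₙ^α(π) = (1/n) ∑ᵢ (E_{a ∼ π₀(· | xᵢ)}[π(a | xᵢ) / π₀(a | xᵢ)^(2α)]
  + π(aᵢ | xᵢ) / π₀(aᵢ | xᵢ)^(2α) cᵢ²)`. -/
def varianceTerm (π₀ : Kernel X (Fin K)) (α : ℝ) (D : Fin n → Sample X K)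
    (π : Kernel X (Fin K)) : ℝ :=
  (1 / (n : ℝ)) * ∑ i,
    ((∫ a, actionProb π a (D i).1.1 / actionProb π₀ a (D i).1.1 ^ (2 * α) ∂(π₀ (D i).1.1)) +
      actionProb π (D i).1.2 (D i).1.1 / actionProb π₀ (D i).1.2 (D i).1.1 ^ (2 * α)
        * (D i).2 ^ 2)

end OffPolicy

end

namespace OffPolicy

theorem integrable_exp_of_bounded {Ω : Type*} [MeasurableSpace Ω] (P : Measure Ω)
    [IsFiniteMeasure P] {f : Ω → ℝ} (hf : Measurable f) {C : ℝ} (hC : ∀ ω, |f ω| ≤ C) :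
    Integrable (fun ω => Real.exp (f ω)) P := by
  refine .of_bound hf.exp.aestronglyMeasurable (Real.exp C) (ae_of_all _ fun ω => ?_)
  rw [Real.norm_of_nonneg (Real.exp_pos _).le]
  exact Real.exp_le_exp.2 ((le_abs_self _).trans (hC ω))

/-- Donsker–Varadhan inequality for bounded functions. -/
theorem integral_le_toReal_klDiv_add_log {Ω : Type*} [MeasurableSpace Ω] (Q P : Measure Ω)
    [IsProbabilityMeasure Q] [IsProbabilityMeasure P] (hQP : klDiv Q P ≠ ⊤)
    {f : Ω → ℝ} (hf : Measurable f) {C : ℝ} (hC : ∀ ω, |f ω| ≤ C) :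
    ∫ ω, f ω ∂Q ≤ (klDiv Q P).toReal + Real.log (∫ ω, Real.exp (f ω) ∂P) := by
  obtain ⟨hac, hint⟩ := klDiv_ne_top_iff.1 hQP
  have hfQ : Integrable f Q := .of_bound hf.aestronglyMeasurable C (ae_of_all _ hC)
  have hexp := integrable_exp_of_bounded P hf hC
  have := isProbabilityMeasure_tilted hexp
  have hac' : Q ≪ P.tilted f := hac.trans (absolutelyContinuous_tilted hexp)
  have h1 := toReal_klDiv_of_measure_eq hac (by simp)
  have h2 := toReal_klDiv_of_measure_eq hac' (by simp)
  have h3 := integral_llr_tilted_right hac hfQ hexp hint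
  have h4 : 0 ≤ (klDiv Q (P.tilted f)).toReal := ENNReal.toReal_nonneg
  linarith

theorem lintegral_pi_prod {ι Ω : Type*} [Fintype ι] [MeasurableSpace Ω] (μ : Measure Ω)
    [IsProbabilityMeasure μ] {f : Ω → ENNReal} (hf : Measurable f) :
    ∫⁻ ω, ∏ i, f (ω i) ∂(Measure.pi fun _ : ι => μ) = (∫⁻ x, f x ∂μ) ^ Fintype.card ι := by
  have hind : iIndepFun (fun (i : ι) (ω : ι → Ω) => f (ω i)) (Measure.pi fun _ : ι => μ) :=
    iIndepFun_pi fun _ => hf.aemeasurable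
  have h := lintegral_prod_eq_prod_lintegral_of_indepFun Finset.univ _ hind
    fun i => hf.comp (measurable_pi_apply i)
  rw [h]
  have h1 : ∀ i : ι, ∫⁻ ω, f (ω i) ∂(Measure.pi fun _ : ι => μ) = ∫⁻ x, f x ∂μ := fun i =>
    (measurePreserving_eval (fun _ : ι => μ) i).lintegral_comp hf
  simp [h1]

theorem sub_sq_div_two_le_log_one_add {x : ℝ} (hx : 0 ≤ x) :
    x - x ^ 2 / 2 ≤ Real.log (1 + x) := by
  refine le_trans ?_ (Real.le_log_one_add_of_nonneg hx)
  rw [le_div_iff₀ (by linarith)]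
  nlinarith [pow_nonneg hx 3]

/-- A smoothed importance weight has quadratically corrected value below the log-wealth of the
unsmoothed one. -/
theorem smoothed_sub_sq_le_log {t b α : ℝ} (ht : 0 ≤ t) (hb₀ : 0 ≤ b) (hb₁ : b ≤ 1)
    (hα₀ : 0 < α) (hα₁ : α ≤ 1) :
    t / b ^ α - t ^ 2 / b ^ (2 * α) / 2 ≤ Real.log (1 + t / b) := by
  have hsq : b ^ (2 * α) = (b ^ α) ^ 2 := by
    rw [mul_comm, Real.rpow_mul hb₀, Real.rpow_two]
  rw [hsq, ← div_pow]
  refine (sub_sq_div_two_le_log_one_add (by positivity)).trans ?_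
  have hle : t / b ^ α ≤ t / b := by
    rcases hb₀.eq_or_lt with rfl | hb
    · simp [Real.zero_rpow hα₀.ne']
    · have := Real.rpow_le_rpow_of_exponent_ge hb hb₁ hα₁
      rw [Real.rpow_one] at this
      gcongr
  have h0 : 0 ≤ t / b ^ α := by positivity
  exact Real.log_le_log (by linarith) (by linarith)

variable {X H : Type*} [MeasurableSpace X] [MeasurableSpace H] {K n : ℕ}

theorem actionProb_nonneg (π : Kernel X (Fin K)) (a : Fin K) (x : X) : 0 ≤ actionProb π a x :=
  measureReal_nonneg

theorem actionProb_le_one (π : Kernel X (Fin K)) [IsMarkovKernel π] (a : Fin K) (x : X) :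
    actionProb π a x ≤ 1 :=
  measureReal_le_one

theorem measurable_actionProb (π : Kernel X (Fin K)) [IsMarkovKernel π] :
    Measurable fun q : X × Fin K => actionProb π q.2 q.1 :=
  measurable_from_prod_countable_left fun a =>
    (π.measurable_coe (measurableSet_singleton a)).ennreal_toReal

instance isMarkovKernel_inducedPolicy (pred : H → X → Fin K)
    (hpred : Measurable fun q : H × X => pred q.1 q.2) (Q : Measure H) [IsProbabilityMeasure Q] :
    IsMarkovKernel (inducedPolicy pred hpred Q) where
  isProbabilityMeasure x := by
    have hm : Measurable fun h => pred h x := hpred.comp measurable_prodMk_right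
    exact Measure.isProbabilityMeasure_map hm.aemeasurable

instance isProbabilityMeasure_jointLaw (ν : Measure X) [IsProbabilityMeasure ν]
    (p : Kernel (X × Fin K) ℝ) [IsMarkovKernel p] (π : Kernel X (Fin K)) [IsMarkovKernel π] :
    IsProbabilityMeasure (jointLaw ν p π) := by
  unfold jointLaw; infer_instance

instance isProbabilityMeasure_dataLaw (ν : Measure X) [IsProbabilityMeasure ν]
    (p : Kernel (X × Fin K) ℝ) [IsMarkovKernel p] (π : Kernel X (Fin K)) [IsMarkovKernel π] :
    IsProbabilityMeasure (dataLaw ν p π n) := by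
  unfold dataLaw; infer_instance

/-- The expected absolute cost of action `a` in context `x`. -/
noncomputable def meanLoss (p : Kernel (X × Fin K) ℝ) (q : X × Fin K) : ENNReal := ∫⁻ c, ‖c‖ₑ ∂(p q)

theorem measurable_meanLoss (p : Kernel (X × Fin K) ℝ) : Measurable (meanLoss p) :=
  measurable_enorm.lintegral_kernel

/-- The expected absolute cost of the deterministic policy `pred h`. -/
noncomputable def hypLoss (ν : Measure X) (p : Kernel (X × Fin K) ℝ) (pred : H → X → Fin K) (h : H) : ENNReal :=
  ∫⁻ x, meanLoss p (x, pred h x) ∂ν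

theorem measurable_meanLoss_pred (p : Kernel (X × Fin K) ℝ) {pred : H → X → Fin K}
    (hpred : Measurable fun q : H × X => pred q.1 q.2) :
    Measurable fun q : H × X => meanLoss p (q.2, pred q.1 q.2) :=
  (measurable_meanLoss p).comp (measurable_snd.prodMk hpred)

theorem measurable_hypLoss (ν : Measure X) [SFinite ν] (p : Kernel (X × Fin K) ℝ)
    {pred : H → X → Fin K} (hpred : Measurable fun q : H × X => pred q.1 q.2) :
    Measurable (hypLoss ν p pred) :=
  (measurable_meanLoss_pred p hpred).lintegral_prod_right'

theorem meanLoss_le_one {p : Kernel (X × Fin K) ℝ} [IsMarkovKernel p]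
    (hp : ∀ x a, ∀ᵐ c ∂(p (x, a)), c ∈ Set.Icc (-1 : ℝ) 0) (q : X × Fin K) :
    meanLoss p q ≤ 1 := by
  calc meanLoss p q ≤ ∫⁻ _, 1 ∂(p q) := by
        refine lintegral_mono_ae ?_
        filter_upwards [hp q.1 q.2] with c hc
        rw [← ofReal_norm, ENNReal.ofReal_le_one, Real.norm_eq_abs, abs_le]
        exact ⟨hc.1, hc.2.trans zero_le_one⟩
    _ = 1 := by simp

theorem hypLoss_le_one {H : Type*} (ν : Measure X) [IsProbabilityMeasure ν] {p : Kernel (X × Fin K) ℝ}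
    [IsMarkovKernel p] (hp : ∀ x a, ∀ᵐ c ∂(p (x, a)), c ∈ Set.Icc (-1 : ℝ) 0)
    (pred : H → X → Fin K) (h : H) : hypLoss ν p pred h ≤ 1 := by
  calc hypLoss ν p pred h ≤ ∫⁻ _, 1 ∂ν := lintegral_mono fun x => meanLoss_le_one hp _
    _ = 1 := by simp

/-- The negated risk of `π_Q` is the `Q`-average of the losses of the hypotheses. -/
theorem risk_inducedPolicy (ν : Measure X) [IsProbabilityMeasure ν] (p : Kernel (X × Fin K) ℝ)
    [IsMarkovKernel p] (hp : ∀ x a, ∀ᵐ c ∂(p (x, a)), c ∈ Set.Icc (-1 : ℝ) 0)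
    {pred : H → X → Fin K} (hpred : Measurable fun q : H × X => pred q.1 q.2)
    (Q : Measure H) [IsProbabilityMeasure Q] :
    risk ν p (inducedPolicy pred hpred Q) = -∫ h, (hypLoss ν p pred h).toReal ∂Q := by
  set π := inducedPolicy pred hpred Q
  have hae : ∀ᵐ z ∂(jointLaw ν p π), z.2 ≤ 0 := by
    refine Measure.ae_compProd_of_ae_ae (measurableSet_le measurable_snd measurable_const)
      (ae_of_all _ fun q => ?_)
    filter_upwards [hp q.1 q.2] with c hc using hc.2
  have h1 : -risk ν p π = (∫⁻ z, ‖z.2‖ₑ ∂(jointLaw ν p π)).toReal := by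
    rw [risk, ← integral_neg, integral_eq_lintegral_of_nonneg_ae]
    · congr 1
      refine lintegral_congr_ae ?_
      filter_upwards [hae] with z hz
      rw [← ofReal_norm, Real.norm_of_nonpos hz]
    · filter_upwards [hae] with z hz
      simpa using hz
    · exact measurable_snd.neg.aestronglyMeasurable
  have h2 : ∫⁻ z, ‖z.2‖ₑ ∂(jointLaw ν p π) = ∫⁻ h, hypLoss ν p pred h ∂Q := by
    rw [jointLaw, Measure.lintegral_compProd measurable_snd.enorm]
    change ∫⁻ q, meanLoss p q ∂(ν ⊗ₘ π) = _
    rw [Measure.lintegral_compProd (measurable_meanLoss p)]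
    simp only [hypLoss]
    rw [lintegral_lintegral_swap (measurable_meanLoss_pred p hpred).aemeasurable]
    refine lintegral_congr fun x => ?_
    change ∫⁻ a, meanLoss p (x, a) ∂(Q.map fun h => pred h x) = _
    exact lintegral_map ((measurable_meanLoss p).comp measurable_prodMk_left)
      (hpred.comp measurable_prodMk_right)
  rw [integral_toReal (measurable_hypLoss ν p hpred).aemeasurable
    (ae_of_all _ fun h => (hypLoss_le_one ν hp pred h).trans_lt ENNReal.one_lt_top), ← h2, ← h1,
    neg_neg]

/-- The log-wealth gained by betting on the importance-weighted absolute cost of `h`. -/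
noncomputable def gain (π₀ : Kernel X (Fin K)) (pred : H → X → Fin K) (lam : ℝ) (h : H) (z : Sample X K) : ℝ :=
  (if pred h z.1.1 = z.1.2 then 1 else 0) *
    Real.log (1 + lam * |z.2| / actionProb π₀ z.1.2 z.1.1)

theorem measurable_gain (π₀ : Kernel X (Fin K)) [IsMarkovKernel π₀] {pred : H → X → Fin K}
    (hpred : Measurable fun q : H × X => pred q.1 q.2) (lam : ℝ) :
    Measurable fun q : Sample X K × H => gain π₀ pred lam q.2 q.1 := by
  have h1 : Measurable fun q : Sample X K × H => pred q.2 q.1.1.1 :=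
    hpred.comp (measurable_snd.prodMk (measurable_fst.comp (measurable_fst.comp measurable_fst)))
  have h2 : Measurable fun q : Sample X K × H => q.1.1.2 :=
    measurable_snd.comp (measurable_fst.comp measurable_fst)
  have h3 : Measurable fun q : Sample X K × H => actionProb π₀ q.1.1.2 q.1.1.1 :=
    (measurable_actionProb π₀).comp (measurable_fst.comp measurable_fst)
  have h4 : Measurable fun q : Sample X K × H => |q.1.2| :=
    (measurable_snd.comp measurable_fst).abs
  refine Measurable.mul (Measurable.ite (measurableSet_eq_fun h1 h2) measurable_const
    measurable_const) ?_
  exact (((h4.const_mul lam).div h3).const_add 1).log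

theorem ofReal_exp_gain {H : Type*} (π₀ : Kernel X (Fin K)) (pred : H → X → Fin K) {lam : ℝ} (hlam : 0 < lam)
    (h : H) (z : Sample X K) :
    ENNReal.ofReal (Real.exp (gain π₀ pred lam h z)) =
      1 + (if pred h z.1.1 = z.1.2 then ENNReal.ofReal (lam / actionProb π₀ z.1.2 z.1.1) else 0)
        * ‖z.2‖ₑ := by
  have hb := actionProb_nonneg π₀ z.1.2 z.1.1
  unfold gain
  split_ifs
  · have h0 : 0 ≤ lam * |z.2| / actionProb π₀ z.1.2 z.1.1 := by positivity
    rw [one_mul, Real.exp_log (by linarith), ENNReal.ofReal_add zero_le_one h0, ENNReal.ofReal_one,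
      mul_div_right_comm, ENNReal.ofReal_mul (by positivity), ← Real.norm_eq_abs,
      ofReal_norm]
  · simp

theorem lintegral_exp_gain_le (ν : Measure X) [IsProbabilityMeasure ν] (p : Kernel (X × Fin K) ℝ)
    [IsMarkovKernel p] (hp : ∀ x a, ∀ᵐ c ∂(p (x, a)), c ∈ Set.Icc (-1 : ℝ) 0)
    (π₀ : Kernel X (Fin K)) [IsMarkovKernel π₀]
    {pred : H → X → Fin K} (hpred : Measurable fun q : H × X => pred q.1 q.2)
    {lam : ℝ} (hlam : 0 < lam) (h : H) :
    ∫⁻ z, ENNReal.ofReal (Real.exp (gain π₀ pred lam h z)) ∂(jointLaw ν p π₀) ≤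
      ENNReal.ofReal (Real.exp (lam * (hypLoss ν p pred h).toReal)) := by
  have hmeas : Measurable fun z => ENNReal.ofReal (Real.exp (gain π₀ pred lam h z)) :=
    ((measurable_gain π₀ hpred lam).comp measurable_prodMk_right).exp.ennreal_ofReal
  have hinner : ∀ q : X × Fin K,
      ∫⁻ c, ENNReal.ofReal (Real.exp (gain π₀ pred lam h (q, c))) ∂(p q) =
        1 + (if pred h q.1 = q.2 then ENNReal.ofReal (lam / actionProb π₀ q.2 q.1) else 0)
          * meanLoss p q := fun q => by
    simp_rw [ofReal_exp_gain π₀ pred hlam]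
    rw [lintegral_add_left measurable_const, lintegral_const_mul _ measurable_enorm]
    simp [meanLoss]
  have hmid : ∀ x, ∫⁻ a, ∫⁻ c, ENNReal.ofReal (Real.exp (gain π₀ pred lam h ((x, a), c)))
      ∂(p (x, a)) ∂(π₀ x) ≤ 1 + ENNReal.ofReal lam * meanLoss p (x, pred h x) := fun x => by
    simp_rw [hinner]
    rw [lintegral_add_left measurable_const, lintegral_const, measure_univ, mul_one, lintegral_fintype]
    simp only [ite_mul, zero_mul, Finset.sum_ite_eq, Finset.mem_univ, if_true]
    gcongr 1 + ?_
    rw [mul_right_comm]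
    gcongr
    have hb := actionProb_nonneg π₀ (pred h x) x
    rw [← ofReal_measureReal]
    change _ * ENNReal.ofReal (actionProb π₀ (pred h x) x) ≤ _
    rw [← ENNReal.ofReal_mul (by positivity)]
    refine ENNReal.ofReal_le_ofReal ?_
    rw [div_mul_eq_mul_div]
    exact div_le_of_le_mul₀ hb hlam.le le_rfl
  have hfin : hypLoss ν p pred h ≠ ⊤ :=
    ((hypLoss_le_one ν hp pred h).trans_lt ENNReal.one_lt_top).ne
  rw [jointLaw, Measure.lintegral_compProd hmeas,
    Measure.lintegral_compProd hmeas.lintegral_kernel_prod_right']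
  calc _ ≤ ∫⁻ x, (1 + ENNReal.ofReal lam * meanLoss p (x, pred h x)) ∂ν := lintegral_mono hmid
    _ = 1 + ENNReal.ofReal lam * hypLoss ν p pred h := by
      have hm : Measurable fun x => meanLoss p (x, pred h x) :=
        (measurable_meanLoss_pred p hpred).comp measurable_prodMk_left
      rw [lintegral_add_left measurable_const, lintegral_const_mul _ hm]
      simp [hypLoss]
    _ = ENNReal.ofReal (1 + lam * (hypLoss ν p pred h).toReal) := by
      rw [ENNReal.ofReal_add zero_le_one (by positivity), ENNReal.ofReal_mul hlam.le,
        ENNReal.ofReal_toReal hfin, ENNReal.ofReal_one]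
    _ ≤ _ := by
      gcongr
      linarith [Real.add_one_le_exp (lam * (hypLoss ν p pred h).toReal)]

/-- The total log-wealth of `h` on the data, compensated by its expected loss. -/
noncomputable def logWealth (ν : Measure X) (p : Kernel (X × Fin K) ℝ) (π₀ : Kernel X (Fin K))
    (pred : H → X → Fin K) (lam : ℝ) (D : Fin n → Sample X K) (h : H) : ℝ :=
  ∑ i, (gain π₀ pred lam h (D i) - lam * (hypLoss ν p pred h).toReal)

theorem measurable_logWealth (ν : Measure X) [SFinite ν] (p : Kernel (X × Fin K) ℝ)
    (π₀ : Kernel X (Fin K)) [IsMarkovKernel π₀] {pred : H → X → Fin K}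
    (hpred : Measurable fun q : H × X => pred q.1 q.2) (lam : ℝ) :
    Measurable fun q : (Fin n → Sample X K) × H => logWealth ν p π₀ pred lam q.1 q.2 := by
  refine Finset.measurable_sum _ fun i _ => Measurable.sub ?_ ?_
  · have hi : Measurable fun q : (Fin n → Sample X K) × H => (q.1 i, q.2) :=
      ((measurable_pi_apply i).comp measurable_fst).prodMk measurable_snd
    exact (measurable_gain π₀ hpred lam).comp hi
  · exact (((measurable_hypLoss ν p hpred).comp measurable_snd).ennreal_toReal).const_mul lam

theorem lintegral_lintegral_exp_logWealth_le_one (ν : Measure X) [IsProbabilityMeasure ν]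
    (p : Kernel (X × Fin K) ℝ) [IsMarkovKernel p]
    (hp : ∀ x a, ∀ᵐ c ∂(p (x, a)), c ∈ Set.Icc (-1 : ℝ) 0)
    (π₀ : Kernel X (Fin K)) [IsMarkovKernel π₀]
    {pred : H → X → Fin K} (hpred : Measurable fun q : H × X => pred q.1 q.2)
    (P : Measure H) [IsProbabilityMeasure P] {lam : ℝ} (hlam : 0 < lam) :
    ∫⁻ D, ∫⁻ h, ENNReal.ofReal (Real.exp (logWealth ν p π₀ pred lam D h)) ∂P
      ∂(dataLaw ν p π₀ n) ≤ 1 := by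
  rw [lintegral_lintegral_swap
    (measurable_logWealth ν p π₀ hpred lam).exp.ennreal_ofReal.aemeasurable]
  have hle : ∀ h, ∫⁻ D, ENNReal.ofReal (Real.exp (logWealth ν p π₀ pred lam D h))
      ∂(dataLaw ν p π₀ n) ≤ 1 := fun h => by
    set r := lam * (hypLoss ν p pred h).toReal with hr
    have hmeas : Measurable fun z => ENNReal.ofReal (Real.exp (gain π₀ pred lam h z)) :=
      ((measurable_gain π₀ hpred lam).comp measurable_prodMk_right).exp.ennreal_ofReal
    have hprod : ∀ D : Fin n → Sample X K,
        ENNReal.ofReal (Real.exp (logWealth ν p π₀ pred lam D h)) =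
          ∏ i, ENNReal.ofReal (Real.exp (-r)) *
            ENNReal.ofReal (Real.exp (gain π₀ pred lam h (D i))) := fun D => by
      rw [logWealth, Real.exp_sum, ENNReal.ofReal_prod_of_nonneg fun _ _ => (Real.exp_pos _).le]
      refine Finset.prod_congr rfl fun i _ => ?_
      rw [← ENNReal.ofReal_mul (Real.exp_pos _).le, ← Real.exp_add, sub_eq_neg_add]
    simp_rw [hprod, dataLaw]
    rw [lintegral_pi_prod _ (hmeas.const_mul _), lintegral_const_mul _ hmeas]
    refine pow_le_one₀ zero_le ?_
    calc _ ≤ ENNReal.ofReal (Real.exp (-r)) * ENNReal.ofReal (Real.exp r) := by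
          gcongr
          exact lintegral_exp_gain_le ν p hp π₀ hpred hlam h
      _ = 1 := by rw [← ENNReal.ofReal_mul (Real.exp_pos _).le, ← Real.exp_add]; simp
  calc _ ≤ ∫⁻ _, 1 ∂P := lintegral_mono hle
    _ = 1 := by simp

theorem abs_logWealth_le {H : Type*} (ν : Measure X) [IsProbabilityMeasure ν] (p : Kernel (X × Fin K) ℝ)
    [IsMarkovKernel p] (hp : ∀ x a, ∀ᵐ c ∂(p (x, a)), c ∈ Set.Icc (-1 : ℝ) 0)
    (π₀ : Kernel X (Fin K)) (pred : H → X → Fin K) {lam : ℝ} (hlam : 0 < lam)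
    (D : Fin n → Sample X K) (h : H) :
    |logWealth ν p π₀ pred lam D h| ≤
      ∑ i, (|Real.log (1 + lam * |(D i).2| / actionProb π₀ (D i).1.2 (D i).1.1)| + lam) := by
  refine (Finset.abs_sum_le_sum_abs _ _).trans (Finset.sum_le_sum fun i _ => ?_)
  refine (abs_sub _ _).trans (add_le_add ?_ ?_)
  · unfold gain
    split_ifs <;> simp
  · have h1 : (hypLoss ν p pred h).toReal ≤ 1 := by
      simpa using ENNReal.toReal_mono ENNReal.one_ne_top (hypLoss_le_one ν hp pred h)
    rw [abs_of_nonneg (by positivity)]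
    exact mul_le_of_le_one_right hlam.le h1

theorem integral_logWealth (ν : Measure X) [IsProbabilityMeasure ν] (p : Kernel (X × Fin K) ℝ)
    [IsMarkovKernel p] (hp : ∀ x a, ∀ᵐ c ∂(p (x, a)), c ∈ Set.Icc (-1 : ℝ) 0)
    (π₀ : Kernel X (Fin K)) {pred : H → X → Fin K}
    (hpred : Measurable fun q : H × X => pred q.1 q.2) (lam : ℝ)
    (Q : Measure H) [IsProbabilityMeasure Q] (D : Fin n → Sample X K) :
    ∫ h, logWealth ν p π₀ pred lam D h ∂Q =
      ∑ i, actionProb (inducedPolicy pred hpred Q) (D i).1.2 (D i).1.1 *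
        Real.log (1 + lam * |(D i).2| / actionProb π₀ (D i).1.2 (D i).1.1)
      + n * (lam * risk ν p (inducedPolicy pred hpred Q)) := by
  have hint1 : Integrable (fun h => lam * (hypLoss ν p pred h).toReal) Q := by
    refine Integrable.const_mul (.of_bound
      (measurable_hypLoss ν p hpred).ennreal_toReal.aestronglyMeasurable 1
      (ae_of_all _ fun h => ?_)) lam
    rw [Real.norm_of_nonneg ENNReal.toReal_nonneg]
    simpa using ENNReal.toReal_mono ENNReal.one_ne_top (hypLoss_le_one ν hp pred h)
  have hint2 : ∀ i, Integrable (fun h => gain π₀ pred lam h (D i)) Q := fun i => by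
    refine Integrable.mul_const (.of_bound ?_ 1 (ae_of_all _ fun h => ?_)) _
    · have hm : Measurable fun h => pred h (D i).1.1 := hpred.comp measurable_prodMk_right
      exact (Measurable.ite (hm (measurableSet_singleton (D i).1.2)) measurable_const
        measurable_const).aestronglyMeasurable
    · split_ifs <;> simp
  have hint3 : ∀ i ∈ Finset.univ, Integrable
      (fun h => gain π₀ pred lam h (D i) - lam * (hypLoss ν p pred h).toReal) Q := fun i _ =>
    (hint2 i).sub hint1
  simp only [logWealth]
  rw [integral_finsetSum _ hint3]
  have hterm : ∀ i, ∫ h, (gain π₀ pred lam h (D i) - lam * (hypLoss ν p pred h).toReal) ∂Q =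
      actionProb (inducedPolicy pred hpred Q) (D i).1.2 (D i).1.1 *
        Real.log (1 + lam * |(D i).2| / actionProb π₀ (D i).1.2 (D i).1.1)
      + lam * risk ν p (inducedPolicy pred hpred Q) := fun i => by
    rw [integral_sub (hint2 i) hint1, integral_const_mul, risk_inducedPolicy ν p hp hpred Q,
      actionProb_inducedPolicy]
    simp only [gain]
    rw [integral_mul_const]
    ring
  simp_rw [hterm]
  rw [Finset.sum_add_distrib]
  simp

theorem biasTerm_nonneg (π₀ : Kernel X (Fin K)) [IsMarkovKernel π₀] {α : ℝ} (hα : α ≤ 1)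
    (D : Fin n → Sample X K) (π : Kernel X (Fin K)) [IsMarkovKernel π] :
    0 ≤ biasTerm π₀ α D π := by
  have h1 : ∀ i, ∫ a, actionProb π₀ a (D i).1.1 ^ (1 - α) ∂(π (D i).1.1) ≤ 1 := fun i => by
    calc _ ≤ ∫ _, (1 : ℝ) ∂(π (D i).1.1) := by
          refine integral_mono .of_finite (integrable_const _) fun a => ?_
          exact Real.rpow_le_one (actionProb_nonneg _ _ _) (actionProb_le_one _ _ _) (by linarith)
      _ = 1 := by simp
  have h2 : ∑ i, ∫ a, actionProb π₀ a (D i).1.1 ^ (1 - α) ∂(π (D i).1.1) ≤ n :=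
    (Finset.sum_le_sum fun i _ => h1 i).trans (by simp)
  rw [biasTerm, sub_nonneg, one_div_mul_eq_div]
  exact div_le_one_of_le₀ h2 (Nat.cast_nonneg n)

theorem sum_le_varianceTerm (π₀ : Kernel X (Fin K)) (α : ℝ) (D : Fin n → Sample X K)
    (π : Kernel X (Fin K)) :
    (1 / (n : ℝ)) * ∑ i, actionProb π (D i).1.2 (D i).1.1 /
      actionProb π₀ (D i).1.2 (D i).1.1 ^ (2 * α) * (D i).2 ^ 2 ≤ varianceTerm π₀ α D π := by
  unfold varianceTerm
  gcongr with i
  refine le_add_of_nonneg_left (integral_nonneg fun a => ?_)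
  exact div_nonneg (actionProb_nonneg _ _ _) (Real.rpow_nonneg (actionProb_nonneg _ _ _) _)

theorem neg_sum_log_le (π₀ : Kernel X (Fin K)) [IsMarkovKernel π₀] {α : ℝ} (hα₀ : 0 < α)
    (hα₁ : α ≤ 1) (D : Fin n → Sample X K) (hD : ∀ i, (D i).2 ≤ 0) (π : Kernel X (Fin K))
    (hn : 1 ≤ n) {lam : ℝ} (hlam : 0 < lam) :
    -∑ i, actionProb π (D i).1.2 (D i).1.1 *
        Real.log (1 + lam * |(D i).2| / actionProb π₀ (D i).1.2 (D i).1.1) ≤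
      n * lam * (smoothedIPS π₀ α D π + lam / 2 * varianceTerm π₀ α D π) := by
  have hn' : (0 : ℝ) < n := by exact_mod_cast hn
  calc _ ≤ ∑ i, (lam * ((D i).2 *
          (actionProb π (D i).1.2 (D i).1.1 / actionProb π₀ (D i).1.2 (D i).1.1 ^ α))
        + lam ^ 2 / 2 * (actionProb π (D i).1.2 (D i).1.1 /
            actionProb π₀ (D i).1.2 (D i).1.1 ^ (2 * α) * (D i).2 ^ 2)) := by
        rw [← Finset.sum_neg_distrib]
        refine Finset.sum_le_sum fun i _ => ?_
        have hπ := actionProb_nonneg π (D i).1.2 (D i).1.1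
        have h1 := smoothed_sub_sq_le_log (t := lam * |(D i).2|) (by positivity)
          (actionProb_nonneg π₀ (D i).1.2 (D i).1.1) (actionProb_le_one π₀ _ _) hα₀ hα₁
        have h2 := mul_le_mul_of_nonneg_left h1 hπ
        rw [mul_pow, sq_abs] at h2
        nth_rewrite 1 [abs_of_nonpos (hD i)] at h2
        calc _ ≤ _ := neg_le_neg h2
          _ = _ := by ring
    _ = n * lam * (smoothedIPS π₀ α D π + lam / 2 * ((1 / (n : ℝ)) *
          ∑ i, actionProb π (D i).1.2 (D i).1.1 /
            actionProb π₀ (D i).1.2 (D i).1.1 ^ (2 * α) * (D i).2 ^ 2)) := by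
        rw [Finset.sum_add_distrib, ← Finset.mul_sum, ← Finset.mul_sum, smoothedIPS]
        field_simp
    _ ≤ _ := by
        gcongr
        exact sum_le_varianceTerm π₀ α D π

theorem ae_dataLaw_nonpos (ν : Measure X) [IsProbabilityMeasure ν] (p : Kernel (X × Fin K) ℝ)
    [IsMarkovKernel p] (hp : ∀ x a, ∀ᵐ c ∂(p (x, a)), c ∈ Set.Icc (-1 : ℝ) 0)
    (π₀ : Kernel X (Fin K)) [IsMarkovKernel π₀] :
    ∀ᵐ D ∂(dataLaw ν p π₀ n), ∀ i, (D i).2 ≤ 0 := by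
  refine ae_all_iff.2 fun i => ?_
  have hae : ∀ᵐ z ∂(jointLaw ν p π₀), z.2 ≤ 0 := by
    refine Measure.ae_compProd_of_ae_ae (measurableSet_le measurable_snd measurable_const)
      (ae_of_all _ fun q => ?_)
    filter_upwards [hp q.1 q.2] with c hc using hc.2
  exact (measurePreserving_eval (fun _ => jointLaw ν p π₀) i).quasiMeasurePreserving.ae hae

/-- The event on which costs are nonpositive and the prior average of the wealth is below
`1 / δ`. -/
def goodEvent (ν : Measure X) (p : Kernel (X × Fin K) ℝ) (π₀ : Kernel X (Fin K))
    (pred : H → X → Fin K) (P : Measure H) (lam δ : ℝ) (n : ℕ) : Set (Fin n → Sample X K) :=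
  {D | ∀ i, (D i).2 ≤ 0} ∩
    {D | ENNReal.ofReal (1 / δ) ≤
      ∫⁻ h, ENNReal.ofReal (Real.exp (logWealth ν p π₀ pred lam D h)) ∂P}ᶜ

theorem measurable_lintegral_exp_logWealth (ν : Measure X) [SFinite ν] (p : Kernel (X × Fin K) ℝ)
    (π₀ : Kernel X (Fin K)) [IsMarkovKernel π₀]
    {pred : H → X → Fin K} (hpred : Measurable fun q : H × X => pred q.1 q.2)
    (P : Measure H) [SFinite P] (lam : ℝ) :
    Measurable fun D : Fin n → Sample X K =>
      ∫⁻ h, ENNReal.ofReal (Real.exp (logWealth ν p π₀ pred lam D h)) ∂P :=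
  (measurable_logWealth ν p π₀ hpred lam).exp.ennreal_ofReal.lintegral_prod_right'

theorem measurableSet_goodEvent (ν : Measure X) [SFinite ν] (p : Kernel (X × Fin K) ℝ)
    (π₀ : Kernel X (Fin K)) [IsMarkovKernel π₀]
    {pred : H → X → Fin K} (hpred : Measurable fun q : H × X => pred q.1 q.2)
    (P : Measure H) [SFinite P] (lam δ : ℝ) :
    MeasurableSet (goodEvent ν p π₀ pred P lam δ n) := by
  refine MeasurableSet.inter ?_ (measurableSet_le measurable_const
    (measurable_lintegral_exp_logWealth ν p π₀ hpred P lam)).compl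
  rw [Set.ofPred_forall]
  exact .iInter fun i => measurableSet_le
    (measurable_snd.comp (measurable_pi_apply i)) measurable_const

theorem le_dataLaw_goodEvent (ν : Measure X) [IsProbabilityMeasure ν] (p : Kernel (X × Fin K) ℝ)
    [IsMarkovKernel p] (hp : ∀ x a, ∀ᵐ c ∂(p (x, a)), c ∈ Set.Icc (-1 : ℝ) 0)
    (π₀ : Kernel X (Fin K)) [IsMarkovKernel π₀]
    {pred : H → X → Fin K} (hpred : Measurable fun q : H × X => pred q.1 q.2)
    (P : Measure H) [IsProbabilityMeasure P] {lam : ℝ} (hlam : 0 < lam) {δ : ℝ} (hδ : 0 < δ) :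
    ENNReal.ofReal (1 - δ) ≤ dataLaw ν p π₀ n (goodEvent ν p π₀ pred P lam δ n) := by
  have hm := measurable_lintegral_exp_logWealth (n := n) ν p π₀ hpred P lam
  set S := {D : Fin n → Sample X K | ENNReal.ofReal (1 / δ) ≤
    ∫⁻ h, ENNReal.ofReal (Real.exp (logWealth ν p π₀ pred lam D h)) ∂P}
  have hS : MeasurableSet S := measurableSet_le measurable_const hm
  have h1 : dataLaw ν p π₀ n S ≤ ENNReal.ofReal δ := by
    refine (meas_ge_le_lintegral_div hm.aemeasurable
      (ENNReal.ofReal_pos.2 (one_div_pos.2 hδ)).ne' ENNReal.ofReal_ne_top).trans ?_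
    refine (ENNReal.div_le_div_right
      (lintegral_lintegral_exp_logWealth_le_one ν p hp π₀ hpred P hlam) _).trans ?_
    rw [one_div, one_div, ENNReal.ofReal_inv_of_pos hδ, inv_inv]
  have h2 : dataLaw ν p π₀ n (goodEvent ν p π₀ pred P lam δ n) = dataLaw ν p π₀ n Sᶜ := by
    refine measure_congr ?_
    filter_upwards [ae_dataLaw_nonpos (n := n) ν p hp π₀] with D hD
    exact propext (and_iff_right hD)
  rw [h2, prob_compl_eq_one_sub hS, ENNReal.ofReal_sub _ hδ.le, ENNReal.ofReal_one]
  exact tsub_le_tsub_left h1 1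

theorem risk_le_of_mem_goodEvent (ν : Measure X) [IsProbabilityMeasure ν]
    (p : Kernel (X × Fin K) ℝ) [IsMarkovKernel p]
    (hp : ∀ x a, ∀ᵐ c ∂(p (x, a)), c ∈ Set.Icc (-1 : ℝ) 0)
    (π₀ : Kernel X (Fin K)) [IsMarkovKernel π₀]
    {pred : H → X → Fin K} (hpred : Measurable fun q : H × X => pred q.1 q.2)
    (P : Measure H) [IsProbabilityMeasure P] (hn : 1 ≤ n) {lam : ℝ} (hlam : 0 < lam)
    {δ : ℝ} (hδ : 0 < δ) {D : Fin n → Sample X K} (hD : D ∈ goodEvent ν p π₀ pred P lam δ n)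
    (Q : Measure H) [IsProbabilityMeasure Q] (hQP : klDiv Q P ≠ ⊤)
    {α : ℝ} (hα₀ : 0 < α) (hα₁ : α ≤ 1) :
    risk ν p (inducedPolicy pred hpred Q) ≤
      smoothedIPS π₀ α D (inducedPolicy pred hpred Q)
      + ((klDiv Q P).toReal + Real.log (1 / δ)) / (n * lam)
      + lam / 2 * varianceTerm π₀ α D (inducedPolicy pred hpred Q) := by
  obtain ⟨hD₀, hD₁⟩ := hD
  have hn' : (0 : ℝ) < n := by exact_mod_cast hn
  have hmeas : Measurable (logWealth ν p π₀ pred lam D) :=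
    (measurable_logWealth ν p π₀ hpred lam).comp measurable_prodMk_left
  have hbd := abs_logWealth_le ν p hp π₀ pred hlam D
  have hdv := integral_le_toReal_klDiv_add_log Q P hQP hmeas hbd
  have hexp := integrable_exp_of_bounded P hmeas hbd
  have hlog : Real.log (∫ h, Real.exp (logWealth ν p π₀ pred lam D h) ∂P) ≤
      Real.log (1 / δ) := by
    refine Real.log_le_log (integral_exp_pos hexp) ?_
    rw [← ENNReal.ofReal_le_ofReal_iff (by positivity),
      ofReal_integral_eq_lintegral_ofReal hexp (ae_of_all _ fun h => (Real.exp_pos _).le)]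
    exact (lt_of_not_ge (Set.notMem_ofPred_iff.1 hD₁)).le
  rw [integral_logWealth ν p hp π₀ hpred lam Q D] at hdv
  have hsum := neg_sum_log_le π₀ hα₀ hα₁ D hD₀ (inducedPolicy pred hpred Q) hn hlam
  have hkey : n * lam * risk ν p (inducedPolicy pred hpred Q) ≤
      n * lam * (smoothedIPS π₀ α D (inducedPolicy pred hpred Q)
        + ((klDiv Q P).toReal + Real.log (1 / δ)) / (n * lam)
        + lam / 2 * varianceTerm π₀ α D (inducedPolicy pred hpred Q)) := by
    have : n * lam * (((klDiv Q P).toReal + Real.log (1 / δ)) / (n * lam)) =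
        (klDiv Q P).toReal + Real.log (1 / δ) := by field_simp
    linarith
  exact le_of_mul_le_mul_left hkey (by positivity)

end OffPolicy

theorem mainTheorem6 {X H : Type*} [MeasurableSpace X] [MeasurableSpace H] {K : ℕ}
    -- context distribution, cost distributions on `[-1, 0]`, logging policy
    (ν : Measure X) [IsProbabilityMeasure ν]
    (p : Kernel (X × Fin K) ℝ) [IsMarkovKernel p]
    (hp : ∀ x a, ∀ᵐ c ∂(p (x, a)), c ∈ Set.Icc (-1 : ℝ) 0)
    (π₀ : Kernel X (Fin K)) [IsMarkovKernel π₀]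
    -- hypothesis space of maps from contexts to actions, and the prior
    (pred : H → X → Fin K) (hpred : Measurable fun q : H × X => pred q.1 q.2)
    (P : Measure H) [IsProbabilityMeasure P]
    (n : ℕ) (hn : 1 ≤ n) (δ : ℝ) (hδ₀ : 0 < δ) (hδ₁ : δ ≤ 1) (lam : ℝ) (hlam : 0 < lam) :
    -- an event of probability at least `1 - δ`, on which the bound holds for all `Q` and `α`;
    -- for `KL(Q ‖ P) = ∞` the right-hand side is infinite and there is nothing to say
    ∃ E : Set (Fin n → OffPolicy.Sample X K), MeasurableSet E ∧
      ENNReal.ofReal (1 - δ) ≤ OffPolicy.dataLaw ν p π₀ n E ∧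
      ∀ D ∈ E, ∀ (Q : Measure H) [IsProbabilityMeasure Q], klDiv Q P ≠ ⊤ →
        ∀ α : ℝ, 0 < α → α ≤ 1 →
          OffPolicy.risk ν p (OffPolicy.inducedPolicy pred hpred Q) ≤
            OffPolicy.smoothedIPS π₀ α D (OffPolicy.inducedPolicy pred hpred Q)
            + Real.sqrt (((klDiv Q P).toReal + Real.log (8 * Real.sqrt n / (δ * α))) / (2 * n))
            + OffPolicy.biasTerm π₀ α D (OffPolicy.inducedPolicy pred hpred Q)
            + ((klDiv Q P).toReal + Real.log (8 / (δ * α))) / (n * lam)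
            + lam / 2 *
              OffPolicy.varianceTerm π₀ α D (OffPolicy.inducedPolicy pred hpred Q) := by
  refine ⟨OffPolicy.goodEvent ν p π₀ pred P lam δ n,
    OffPolicy.measurableSet_goodEvent ν p π₀ hpred P lam δ,
    OffPolicy.le_dataLaw_goodEvent ν p hp π₀ hpred P hlam hδ₀, fun D hD Q _ hQP α hα₀ hα₁ => ?_⟩
  have hn' : (0 : ℝ) < n := by exact_mod_cast hn
  have h1 := OffPolicy.risk_le_of_mem_goodEvent ν p hp π₀ hpred P hn hlam hδ₀ hD Q hQP hα₀ hα₁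
  have h2 := OffPolicy.biasTerm_nonneg π₀ hα₁ D (OffPolicy.inducedPolicy pred hpred Q)
  have h3 := Real.sqrt_nonneg
    (((klDiv Q P).toReal + Real.log (8 * Real.sqrt n / (δ * α))) / (2 * n))
  have h4 : ((klDiv Q P).toReal + Real.log (1 / δ)) / (n * lam) ≤
      ((klDiv Q P).toReal + Real.log (8 / (δ * α))) / (n * lam) := by
    gcongr
    · norm_num
    · exact mul_le_of_le_one_right hδ₀.le hα₁
  linarith
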